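/- Let $R$ be a (not necessarily commutative) ring with identity that is an Asano prime ring, i.e. a prime (left and right) Goldie ring in which every nonzero two-sided ideal $I$ is invertible: in the classical quotient ring $Q$ of $R$ there is an $R$-$R$-subbimodule $J$ with $IJ=JI=R$. Let $\{X_i\}_{i\in I}$ be the set of all maximal (two-sided) ideals of $R$, let $M$ be a unital right $R$-module, and let $Y\subseteq M$ be a generating set of $M$. For an ideal $X$ of $R$ put $C(X)=\sum_{k\ge 1}\{m\in M\mid mX^{k}=0\}$, and for $N\subseteq M$ put $\underline{r}_R(N)=\{r\in R\mid nr=0\text{ for all }n\in N\}$. If $\underline{r}_R(yR)\neq 0$ for every $y\in Y$, then $M$ is the internal direct sum $M=\bigoplus_{i\in I}C(X_i)$. -/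

import Mathlib

open scoped RightActions Pointwise

namespace Asano

/-! Right `R`-modules are modules over `Rᵐᵒᵖ`; `m <• r` is the action of `r : R` on the right.
An ideal of `R` is a (left) `Ideal R` that is two-sided; products and powers are those of `Ideal R`.
-/

section Annihilators

universe u v

variable (R : Type u) [Ring R] {M : Type v} [AddCommGroup M] [Module Rᵐᵒᵖ M]

/-- The right annihilator `{r ∈ R | n r = 0 for all n ∈ N}` of a subset `N` of a right module,
as a right ideal of `R`. -/
def rightAnnihilator (N : Set M) : Submodule Rᵐᵒᵖ R where
  carrier := {r | ∀ n ∈ N, n <• r = 0}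
  zero_mem' := fun n _ => by simp
  add_mem' := fun {a b} ha hb n hn => by
    rw [MulOpposite.op_add, add_smul, ha n hn, hb n hn, add_zero]
  smul_mem' := fun c r hr n hn => by
    have h : MulOpposite.op (c • r) = c * MulOpposite.op r := rfl
    rw [h, mul_smul, hr n hn, smul_zero]

variable {R} (M)

/-- The left annihilator `{m ∈ M | m x = 0 for all x ∈ X}` of an ideal `X` in a right module `M`,
as a submodule of `M`. -/
def leftAnnihilator (X : Ideal R) : Submodule Rᵐᵒᵖ M where
  carrier := {m | ∀ x ∈ X, m <• x = 0}
  zero_mem' := fun x _ => smul_zero _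
  add_mem' := fun {a b} ha hb x hx => by rw [smul_add, ha x hx, hb x hx, add_zero]
  smul_mem' := fun c m hm x hx => by
    have h := hm (c.unop * x) (X.mul_mem_left _ hx)
    rwa [MulOpposite.op_mul, MulOpposite.op_unop, mul_smul] at h

/-- The component of `X` in `M`: the sum over all `k ≥ 1` of the left annihilators of `X ^ k`. -/
def component (X : Ideal R) : Submodule Rᵐᵒᵖ M :=
  ⨆ (k : ℕ) (_ : 1 ≤ k), leftAnnihilator M (X ^ k)

end Annihilators

section Rings

universe u

variable (R : Type u) [Ring R]

/-- A prime ring: `R ≠ 0`, and `a R b = 0` implies `a = 0` or `b = 0`. -/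
def IsPrimeRing : Prop :=
  Nontrivial R ∧ ∀ a b : R, (∀ r : R, a * r * b = 0) → a = 0 ∨ b = 0

/-- A right Goldie ring: there is no infinite direct sum of nonzero right ideals inside `R`
(finite right uniform dimension), and right annihilators of subsets of `R` satisfy the ascending
chain condition. -/
def IsRightGoldie : Prop :=
  (¬ ∃ A : ℕ → Submodule Rᵐᵒᵖ R, (∀ n, A n ≠ ⊥) ∧ iSupIndep A) ∧
    WellFoundedGT {A : Submodule Rᵐᵒᵖ R // ∃ S : Set R, A = rightAnnihilator R S}

/-- A Goldie ring: right Goldie and left Goldie. -/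
def IsGoldie : Prop :=
  IsRightGoldie R ∧ IsRightGoldie Rᵐᵒᵖ

variable {R} {Q : Type u} [Ring Q]

/-- `i : R → Q` exhibits `Q` as the (two-sided) classical quotient ring of `R`: `i` is injective,
regular elements of `R` become units of `Q`, and every element of `Q` is a right fraction `a s⁻¹`
and a left fraction `t⁻¹ b`, with `s`, `t` regular. -/
structure IsQuotientRing (i : R →+* Q) : Prop where
  injective : Function.Injective i
  isUnit : ∀ s ∈ nonZeroDivisors R, IsUnit (i s)
  right_fraction : ∀ q : Q, ∃ a : R, ∃ s ∈ nonZeroDivisors R, q * i s = i a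
  left_fraction : ∀ q : Q, ∃ b : R, ∃ t ∈ nonZeroDivisors R, i t * q = i b

/-- `I` is invertible in the overring `i : R → Q`: there is an `R`-`R`-sub-bimodule `J` of `Q` with
`I J = J I = R`. The product of two additive subgroups is the additive subgroup generated by the
products of their elements. -/
def IsInvertibleIn (i : R →+* Q) (I : Ideal R) : Prop :=
  ∃ J : AddSubgroup Q,
    (∀ (r : R), ∀ q ∈ J, i r * q ∈ J ∧ q * i r ∈ J) ∧
    I.toAddSubgroup.map i.toAddMonoidHom * J = i.range.toAddSubgroup ∧
    J * I.toAddSubgroup.map i.toAddMonoidHom = i.range.toAddSubgroup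

variable (R)

/-- An Asano prime ring (Asano order): a prime Goldie ring in which every nonzero (two-sided) ideal
is invertible, in the quotient ring of `R`. -/
def IsAsanoPrimeRing : Prop :=
  IsPrimeRing R ∧ IsGoldie R ∧
    ∃ (Q : Type u) (_ : Ring Q) (i : R →+* Q), IsQuotientRing i ∧
      ∀ I : Ideal R, I.IsTwoSided → I ≠ ⊥ → IsInvertibleIn i I

variable {R}

/-- `X` is a maximal ideal of `R` in the two-sided sense: a proper two-sided ideal such that every
strictly larger two-sided ideal is `R`. -/
def IsMaximalTwoSided (X : Ideal R) : Prop :=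
  X.IsTwoSided ∧ X ≠ ⊤ ∧ ∀ J : Ideal R, J.IsTwoSided → X < J → J = ⊤

end Rings

end Asano

namespace Asano

/-! ### Arithmetic of invertible two-sided ideals -/

section InvertibleIdeals

universe u

variable {R Q : Type u} [Ring R] [Ring Q] {i : R →+* Q}

/-! Invertibility of `I` means that 1 is a finite sum of products `x q` with `x ∈ I` and `q ∈ I⁻¹`.
This gives division, cancellation and the ascending chain condition for two-sided ideals, so a
nonzero proper `A` inside a maximal `X` factors as `X ^ k * B` with `B` not inside `X`. Then `X ^ k`
and `B` are comaximal and `B * X ^ k ≤ A`; writing `1 = x + b` splits any `m` killed by `A` into `m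
x`, killed by `B`, and `m b`, killed by `X ^ k`. Induction on `A` puts `m` in the sum of the
components. Independence needs only comaximality of distinct maximal ideals. -/

theorem isTwoSided_sup (I J : Ideal R) [I.IsTwoSided] [J.IsTwoSided] : (I ⊔ J).IsTwoSided := by
  refine ⟨fun {a} b ha => ?_⟩
  obtain ⟨x, hx, y, hy, rfl⟩ := Submodule.mem_sup.1 ha
  rw [add_mul]
  exact Submodule.add_mem_sup (I.mul_mem_right b hx) (J.mul_mem_right b hy)

/-- To prove an additive property of the identity of `Q` it suffices, if `I` is invertible, to
prove it for products `x q` with `x ∈ I` and `q` in an inverse of `I`. -/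
theorem IsInvertibleIn.induction_one {I : Ideal R} (hI : IsInvertibleIn i I) {p : Q → Prop}
    (hmul : ∀ x ∈ I, ∀ q : Q, (∀ y ∈ I, ∃ r, i r = i y * q) → (∀ y ∈ I, ∃ r, i r = q * i y) →
      p (i x * q))
    (hadd : ∀ a b, p a → p b → p (a + b)) : p 1 := by
  obtain ⟨J, -, hIJ, hJI⟩ := hI
  have h1 : (1 : Q) ∈ I.toAddSubgroup.map i.toAddMonoidHom * J := by
    rw [hIJ]
    exact ⟨1, map_one i⟩
  refine AddSubmonoid.mul_induction_on (C := p) h1 ?_ hadd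
  rintro _ ⟨x, hx, rfl⟩ q hq
  refine hmul x hx q (fun y hy => ?_) (fun y hy => ?_)
  · have : i y * q ∈ i.range.toAddSubgroup := hIJ ▸ AddSubmonoid.mul_mem_mul ⟨y, hy, rfl⟩ hq
    exact this
  · have : q * i y ∈ i.range.toAddSubgroup := hJI ▸ AddSubmonoid.mul_mem_mul hq ⟨y, hy, rfl⟩
    exact this

/-- To contain is to divide, for an invertible ideal. -/
theorem IsInvertibleIn.exists_eq_mul (hi : Function.Injective i) {I : Ideal R} [I.IsTwoSided]
    (hI : IsInvertibleIn i I) (J : Ideal R) [J.IsTwoSided] (hJI : J ≤ I) :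
    ∃ C : Ideal R, C.IsTwoSided ∧ J = I * C := by
  -- `C` plays the role of `I⁻¹ J`, described without leaving `R`.
  let C : Ideal R :=
    { carrier := {r | ∀ x ∈ I, x * r ∈ J}
      zero_mem' := fun x _ => by simp
      add_mem' := fun {a b} ha hb x hx => by
        rw [mul_add]
        exact J.add_mem (ha x hx) (hb x hx)
      smul_mem' := fun s r hr x hx => by
        rw [smul_eq_mul, ← mul_assoc]
        exact hr _ (I.mul_mem_right s hx) }
  refine ⟨C, ⟨fun {a} b ha x hx => ?_⟩, le_antisymm (fun j hj => ?_)
    (Ideal.mul_le.2 fun x hx r hr => hr x hx)⟩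
  · rw [← mul_assoc]
    exact J.mul_mem_right b (ha x hx)
  · obtain ⟨z, hz, hzj⟩ : ∃ z ∈ I * C, i z = 1 * i j := by
      refine hI.induction_one (p := fun t => ∃ z ∈ I * C, i z = t * i j) ?_ ?_
      · intro x hx q hq hq'
        obtain ⟨r, hr⟩ := hq' j (hJI hj)
        refine ⟨x * r, Ideal.mul_mem_mul hx fun y hy => ?_, by rw [map_mul, hr, mul_assoc]⟩
        obtain ⟨s, hs⟩ := hq y hy
        have : y * r = s * j := hi (by rw [map_mul, map_mul, hr, hs, mul_assoc])
        rw [this]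
        exact J.mul_mem_left s hj
      · rintro a b ⟨z, hz, hza⟩ ⟨w, hw, hwb⟩
        exact ⟨z + w, add_mem hz hw, by rw [map_add, hza, hwb, add_mul]⟩
    rw [one_mul] at hzj
    rwa [← hi hzj]

/-- Cancellation: multiply `B ≤ X * B` on the right by the inverse of `B`. -/
theorem IsInvertibleIn.eq_top_of_le_mul (hi : Function.Injective i) {B : Ideal R}
    (hB : IsInvertibleIn i B) (X : Ideal R) [X.IsTwoSided] (h : B ≤ X * B) : X = ⊤ := by
  obtain ⟨z, hz, hz1⟩ : ∃ z ∈ X, i z = 1 := by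
    refine hB.induction_one (p := fun t => ∃ z ∈ X, i z = t) ?_ ?_
    · intro x hx q hq _
      refine Submodule.mul_induction_on (C := fun x => ∃ z ∈ X, i z = i x * q) (h hx) ?_ ?_
      · intro y hy b hb
        obtain ⟨r, hr⟩ := hq b hb
        exact ⟨y * r, X.mul_mem_right r hy, by rw [map_mul, map_mul, hr, mul_assoc]⟩
      · rintro a b ⟨z, hz, hza⟩ ⟨w, hw, hwb⟩
        exact ⟨z + w, add_mem hz hw, by rw [map_add, map_add, hza, hwb, add_mul]⟩
    · rintro a b ⟨z, hz, hza⟩ ⟨w, hw, hwb⟩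
      exact ⟨z + w, add_mem hz hw, by rw [map_add, hza, hwb]⟩
  rw [Ideal.eq_top_iff_one]
  rwa [hi (hz1.trans (map_one i).symm)] at hz

/-- Let `U` be the union of a chain and `1 = ∑ x q` with `x ∈ U`, `q ∈ U⁻¹`. The finitely many `x`
lie in one member of the chain, which then contains `U = ∑ x (q U)`, because `q U ⊆ R`. -/
theorem wellFoundedGT_isTwoSided (hi : Function.Injective i)
    (hinv : ∀ I : Ideal R, I.IsTwoSided → I ≠ ⊥ → IsInvertibleIn i I) :
    WellFoundedGT {I : Ideal R // I.IsTwoSided} := by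
  rw [wellFoundedGT_iff_monotone_chain_condition]
  intro f
  have hmono : Monotone fun n => (f n).1 := fun m n h => f.monotone h
  let U : Ideal R := ⨆ n, (f n).1
  have hmem : ∀ {x}, x ∈ U ↔ ∃ n, x ∈ (f n).1 :=
    Submodule.mem_iSup_of_directed _ hmono.directed_le
  have hU : U.IsTwoSided := ⟨fun {a} b ha => by
    obtain ⟨n, hn⟩ := hmem.1 ha
    have := (f n).2
    exact hmem.2 ⟨n, (f n).1.mul_mem_right b hn⟩⟩
  have hle : ∀ n, (f n).1 ≤ U := le_iSup fun n => (f n).1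
  obtain ⟨n, hn⟩ : ∃ n, U ≤ (f n).1 := by
    by_cases h0 : U = ⊥
    · exact ⟨0, h0 ▸ bot_le⟩
    obtain ⟨n, hn⟩ : ∃ n, ∀ y ∈ U, ∃ z ∈ (f n).1, i z = 1 * i y := by
      refine (hinv U hU h0).induction_one
        (p := fun t => ∃ n, ∀ y ∈ U, ∃ z ∈ (f n).1, i z = t * i y) ?_ ?_
      · intro x hx q _ hq
        obtain ⟨n, hn⟩ := hmem.1 hx
        refine ⟨n, fun y hy => ?_⟩
        obtain ⟨r, hr⟩ := hq y hy
        have := (f n).2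
        exact ⟨x * r, (f n).1.mul_mem_right r hn, by rw [map_mul, hr, mul_assoc]⟩
      · rintro a b ⟨m, hm⟩ ⟨n, hn⟩
        refine ⟨max m n, fun y hy => ?_⟩
        obtain ⟨z, hz, hza⟩ := hm y hy
        obtain ⟨w, hw, hwb⟩ := hn y hy
        exact ⟨z + w, add_mem (hmono (le_max_left m n) hz) (hmono (le_max_right m n) hw),
          by rw [map_add, hza, hwb, add_mul]⟩
    refine ⟨n, fun y hy => ?_⟩
    obtain ⟨z, hz, hzy⟩ := hn y hy
    rw [one_mul] at hzy
    rwa [← hi hzy]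
  exact ⟨n, fun m hm => Subtype.ext ((hmono hm).antisymm ((hle m).trans hn))⟩

/-- An invertible two-sided ideal commutes, up to inclusion, with every comaximal one. -/
theorem IsInvertibleIn.mul_le_mul_of_sup_eq_top (hi : Function.Injective i) {I J : Ideal R}
    [I.IsTwoSided] [J.IsTwoSided] (hI : IsInvertibleIn i I) (h : I ⊔ J = ⊤) :
    J * I ≤ I * J := by
  obtain ⟨C, hC, hIC⟩ := hI.exists_eq_mul hi (J * I) Ideal.mul_le_right
  have hCJ : C ≤ J := by
    calc C = (I ⊔ J) * C := by rw [h, Ideal.top_mul]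
      _ = I * C ⊔ J * C := Ideal.sup_mul I J C
      _ ≤ J := sup_le (hIC ▸ Ideal.mul_le_left) Ideal.mul_le_left
  rw [hIC]
  exact Ideal.mul_mono_right hCJ

theorem IsMaximalTwoSided.sup_eq_top {X : Ideal R} (hX : IsMaximalTwoSided X) (B : Ideal R)
    [B.IsTwoSided] (hB : ¬ B ≤ X) : X ⊔ B = ⊤ := by
  have := hX.1
  exact hX.2.2 _ (isTwoSided_sup X B) (left_lt_sup.2 hB)

theorem exists_isMaximalTwoSided_ge [WellFoundedGT {I : Ideal R // I.IsTwoSided}] (A : Ideal R)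
    (hA : A.IsTwoSided) (hA1 : A ≠ ⊤) : ∃ X, IsMaximalTwoSided X ∧ A ≤ X := by
  obtain ⟨X, ⟨hX1, hAX⟩, hmax⟩ := wellFounded_gt.has_min
    {I : {I : Ideal R // I.IsTwoSided} | I.1 ≠ ⊤ ∧ A ≤ I.1} ⟨⟨A, hA⟩, hA1, le_rfl⟩
  refine ⟨X.1, ⟨X.2, hX1, fun J hJ hXJ => ?_⟩, hAX⟩
  by_contra hJ1
  exact hmax ⟨J, hJ⟩ ⟨hJ1, hAX.trans hXJ.le⟩ hXJ

/-- Splitting off the `X`-primary part of a nonzero ideal. -/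
theorem exists_eq_pow_mul [WellFoundedGT {I : Ideal R // I.IsTwoSided}]
    (hi : Function.Injective i)
    (hinv : ∀ I : Ideal R, I.IsTwoSided → I ≠ ⊥ → IsInvertibleIn i I) {X : Ideal R}
    (hX : IsMaximalTwoSided X) (A : Ideal R) (hA : A.IsTwoSided) (hA0 : A ≠ ⊥) :
    ∃ (k : ℕ) (B : Ideal R), B.IsTwoSided ∧ ¬ B ≤ X ∧ A = X ^ k * B := by
  have := hX.1
  -- A maximal cofactor `B` works: if `B = X * C`, then `C` is again a cofactor, and it is strictly
  -- larger, since `B = X * B` would force `X = ⊤`.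
  obtain ⟨B, ⟨k, hk⟩, hmax⟩ := wellFounded_gt.has_min
    {B : {I : Ideal R // I.IsTwoSided} | ∃ k, A = X ^ k * B.1}
    ⟨⟨A, hA⟩, 0, by rw [Submodule.pow_zero, Ideal.one_eq_top, Ideal.top_mul]⟩
  have hB := B.2
  have hB0 : B.1 ≠ ⊥ := fun h => hA0 (by rw [hk, h, Ideal.mul_bot])
  refine ⟨k, B.1, hB, fun hBX => ?_, hk⟩
  have hX0 : X ≠ ⊥ := fun h => hB0 (le_bot_iff.1 (h ▸ hBX))
  obtain ⟨C, hC, hBC⟩ := (hinv X hX.1 hX0).exists_eq_mul hi B.1 hBX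
  refine hmax ⟨C, hC⟩ ⟨k + 1, ?_⟩ (lt_of_le_of_ne ?_ ?_)
  · rw [hk, Ideal.IsTwoSided.pow_add, Submodule.pow_one, Ideal.mul_assoc, ← hBC]
  · exact hBC.le.trans Ideal.mul_le_right
  · intro h
    refine hX.2.1 ((hinv B.1 hB hB0).eq_top_of_le_mul hi X ?_)
    rw [show C = B.1 from congrArg Subtype.val h.symm] at hBC
    exact hBC.le

end InvertibleIdeals

/-! ### Components of a right module -/

section Components

universe u v

variable {R : Type u} [Ring R] {M : Type v} [AddCommGroup M] [Module Rᵐᵒᵖ M]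

theorem mem_leftAnnihilator {X : Ideal R} {m : M} :
    m ∈ leftAnnihilator M X ↔ ∀ x ∈ X, m <• x = 0 :=
  Iff.rfl

theorem leftAnnihilator_anti {X Y : Ideal R} (h : X ≤ Y) :
    leftAnnihilator M Y ≤ leftAnnihilator M X :=
  fun _ hm x hx => hm x (h hx)

theorem leftAnnihilator_pow_le_component (X : Ideal R) (k : ℕ) :
    leftAnnihilator M (X ^ k) ≤ component M X :=
  -- Passing to `k + 1` covers `k = 0`, which the definition of `component` omits.
  (leftAnnihilator_anti (Ideal.pow_le_pow_right k.le_succ)).trans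
    (le_iSup₂_of_le (k + 1) k.succ_pos le_rfl)

theorem leftAnnihilator_sup_eq_bot {I J : Ideal R} (h : I ⊔ J = ⊤) {m : M}
    (hI : m ∈ leftAnnihilator M I) (hJ : m ∈ leftAnnihilator M J) : m = 0 := by
  obtain ⟨x, hx, y, hy, hxy⟩ := Submodule.mem_sup.1 ((Ideal.eq_top_iff_one _).1 h)
  rw [← one_smul Rᵐᵒᵖ m, ← MulOpposite.op_one, ← hxy, MulOpposite.op_add, add_smul,
    hI x hx, hJ y hy, add_zero]

theorem mem_component_iff {X : Ideal R} {m : M} :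
    m ∈ component M X ↔ ∃ k, m ∈ leftAnnihilator M (X ^ k) := by
  refine ⟨fun hm => ?_, fun ⟨k, hk⟩ => leftAnnihilator_pow_le_component X k hk⟩
  have hmono : Monotone fun k => leftAnnihilator M (X ^ k) :=
    fun a b h => leftAnnihilator_anti (Ideal.pow_le_pow_right h)
  refine (Submodule.mem_iSup_of_directed _ hmono.directed_le).1 ?_
  have hle : component M X ≤ ⨆ k, leftAnnihilator M (X ^ k) :=
    iSup_le fun k => iSup_le fun _ => le_iSup (fun k => leftAnnihilator M (X ^ k)) k
  exact hle hm

variable (M) in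
/-- The elements killed by a two-sided ideal comaximal with `X`. -/
def comaximalTorsion (X : Ideal R) : Submodule Rᵐᵒᵖ M where
  carrier := {m | ∃ D : Ideal R, D.IsTwoSided ∧ X ⊔ D = ⊤ ∧ m ∈ leftAnnihilator M D}
  zero_mem' := ⟨⊤, inferInstance, sup_top_eq _, zero_mem _⟩
  add_mem' := by
    rintro a b ⟨D, hD, hXD, ha⟩ ⟨E, hE, hXE, hb⟩
    refine ⟨D * E, inferInstance, ?_, add_mem (leftAnnihilator_anti Ideal.mul_le_left ha)
      (leftAnnihilator_anti Ideal.mul_le_right hb)⟩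
    rwa [Ideal.sup_mul_eq_of_coprime_right hXE]
  smul_mem' := fun c _ ⟨D, hD, hXD, hm⟩ => ⟨D, hD, hXD, Submodule.smul_mem _ c hm⟩

theorem disjoint_component_comaximalTorsion (X : Ideal R) [X.IsTwoSided] :
    Disjoint (component M X) (comaximalTorsion M X) := by
  rw [Submodule.disjoint_def]
  rintro m hm ⟨D, hD, hXD, hmD⟩
  obtain ⟨k, hk⟩ := mem_component_iff.1 hm
  exact leftAnnihilator_sup_eq_bot (Ideal.pow_sup_eq_top hXD) hk hmD

theorem component_le_comaximalTorsion {X Y : Ideal R} [X.IsTwoSided] [Y.IsTwoSided]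
    (h : X ⊔ Y = ⊤) : component M Y ≤ comaximalTorsion M X := fun _ hm =>
  let ⟨k, hk⟩ := mem_component_iff.1 hm
  ⟨Y ^ k, inferInstance, Ideal.sup_pow_eq_top h, hk⟩

/-- All components other than that of `X` lie in the single submodule `comaximalTorsion M X`, which
meets the component of `X` trivially. -/
theorem iSupIndep_component :
    iSupIndep fun X : {X : Ideal R // IsMaximalTwoSided X} => component M X.1 := by
  intro X
  have hX := X.2.1
  refine (disjoint_component_comaximalTorsion X.1).mono_right (iSup₂_le fun Y hYX => ?_)
  have hY := Y.2.1
  refine component_le_comaximalTorsion (X.2.sup_eq_top Y.1 fun hle => hYX ?_)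
  by_contra hne
  exact X.2.2.1 (Y.2.2.2 _ hX (lt_of_le_of_ne hle fun h => hne (Subtype.ext h)))

theorem leftAnnihilator_le_iSup_component {Q : Type u} [Ring Q] {i : R →+* Q}
    (hi : Function.Injective i)
    (hinv : ∀ I : Ideal R, I.IsTwoSided → I ≠ ⊥ → IsInvertibleIn i I) (A : Ideal R)
    (hA : A.IsTwoSided) (hA0 : A ≠ ⊥) :
    leftAnnihilator M A ≤
      ⨆ X : {X : Ideal R // IsMaximalTwoSided X}, component M X.1 := by
  have hwf := wellFoundedGT_isTwoSided hi hinv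
  suffices ∀ A : {I : Ideal R // I.IsTwoSided}, A.1 ≠ ⊥ → leftAnnihilator M A.1 ≤
      ⨆ X : {X : Ideal R // IsMaximalTwoSided X}, component M X.1 from this ⟨A, hA⟩ hA0
  clear! A
  intro A
  induction A using WellFoundedGT.induction with
  | ind A ih =>
  obtain ⟨A, hA⟩ := A
  intro hA0 m hm
  by_cases hA1 : A = ⊤
  · have hm0 : m = 0 := leftAnnihilator_sup_eq_bot (I := A) (J := A) (by simp [hA1]) hm hm
    exact hm0 ▸ zero_mem _
  obtain ⟨X, hX, hAX⟩ := exists_isMaximalTwoSided_ge A hA hA1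
  have hX2 := hX.1
  obtain ⟨k, B, hB, hBX, hAB⟩ := exists_eq_pow_mul hi hinv hX A hA hA0
  have hB0 : B ≠ ⊥ := fun h => hBX (h ▸ bot_le)
  have hXk0 : X ^ k ≠ ⊥ := fun h => hA0 (hAB.trans (by rw [h, Ideal.bot_mul]))
  have hcop : X ^ k ⊔ B = ⊤ := Ideal.pow_sup_eq_top (hX.sup_eq_top B hBX)
  -- Needed for `m b`: its products with `X ^ k` come in the order opposite to `A = X ^ k * B`.
  have hcomm : B * X ^ k ≤ A :=
    hAB ▸ (hinv _ inferInstance hXk0).mul_le_mul_of_sup_eq_top hi hcop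
  obtain ⟨x, hx, b, hb, hxb⟩ := Submodule.mem_sup.1 ((Ideal.eq_top_iff_one _).1 hcop)
  have hAB' : A < B :=
    lt_of_le_of_ne (hAB.le.trans Ideal.mul_le_right) fun h => hBX (h ▸ hAX)
  have hmx : m <• x ∈ leftAnnihilator M B := fun c hc => by
    rw [smul_smul, ← MulOpposite.op_mul]
    exact hm _ (hAB.ge (Ideal.mul_mem_mul hx hc))
  have hmb : m <• b ∈ leftAnnihilator M (X ^ k) := fun c hc => by
    rw [smul_smul, ← MulOpposite.op_mul]
    exact hm _ (hcomm (Ideal.mul_mem_mul hb hc))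
  have hsum : m = m <• x + m <• b := by
    rw [← add_smul, ← MulOpposite.op_add, hxb, MulOpposite.op_one, one_smul]
  rw [hsum]
  exact add_mem (ih ⟨B, hB⟩ hAB' hB0 hmx)
    (Submodule.mem_iSup_of_mem (⟨X, hX⟩ : {X : Ideal R // IsMaximalTwoSided X})
      (leftAnnihilator_pow_le_component X k hmb))

variable (R) in
/-- The right annihilator of a submodule, as a two-sided ideal. -/
def annihilatorIdeal (N : Submodule Rᵐᵒᵖ M) : Ideal R where
  carrier := rightAnnihilator R (N : Set M)
  zero_mem' := zero_mem _
  add_mem' := add_mem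
  smul_mem' := fun s r hr n hn => by
    rw [smul_eq_mul, MulOpposite.op_mul, mul_smul]
    exact hr _ (N.smul_mem _ hn)

theorem isTwoSided_annihilatorIdeal (N : Submodule Rᵐᵒᵖ M) :
    (annihilatorIdeal R N).IsTwoSided :=
  ⟨fun {_} b ha => (rightAnnihilator R (N : Set M)).smul_mem (MulOpposite.op b) ha⟩

end Components

end Asano

open Classical in
theorem mainTheorem6 {R : Type*} [Ring R] (hR : Asano.IsAsanoPrimeRing R)
    {M : Type*} [AddCommGroup M] [Module Rᵐᵒᵖ M]
    (Y : Set M) (hY : Submodule.span Rᵐᵒᵖ Y = ⊤)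
    (hann : ∀ y ∈ Y, Asano.rightAnnihilator R (Submodule.span Rᵐᵒᵖ {y} : Set M) ≠ ⊥) :
    DirectSum.IsInternal
      (fun X : {X : Ideal R // Asano.IsMaximalTwoSided X} => Asano.component M X.1) := by
  obtain ⟨-, -, Q, _, i, hQ, hinv⟩ := hR
  refine DirectSum.isInternal_submodule_of_iSupIndep_of_iSup_eq_top
    Asano.iSupIndep_component (top_unique ?_)
  rw [← hY, Submodule.span_le]
  intro y hy
  -- The annihilator of the whole submodule `yR` is used because it is two-sided.
  refine Asano.leftAnnihilator_le_iSup_component hQ.injective hinv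
    (Asano.annihilatorIdeal R (Submodule.span Rᵐᵒᵖ {y})) (Asano.isTwoSided_annihilatorIdeal _)
    (fun h => hann y hy ?_) (fun x hx => hx y (Submodule.mem_span_singleton_self y))
  refine (Submodule.eq_bot_iff _).2 fun r hr => ?_
  have hr' : r ∈ Asano.annihilatorIdeal R (Submodule.span Rᵐᵒᵖ {y}) := hr
  rwa [h] at hr'
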